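/- Let $k\ge 1$ be an integer. For an integer $n>1$, place vertices $v_1,\dots,v_n$ in this order on a circle. A noncrossing tree with $n$ vertices is a tree on the vertex set $\{v_1,\dots,v_n\}$ whose edges, drawn as line segments, do not intersect at interior points; its root is $v_1$. A $k$-noncrossing tree is a noncrossing tree together with an assignment of a label in $\{1,\dots,k\}$ to each vertex such that, whenever $v_i,v_j$ with $i<j$ are adjacent and the path from the root $v_1$ to $v_j$ contains $v_i$, the sum of the labels of $v_i$ and $v_j$ is at most $k+1$. For every integer $n>1$, the total number of $k$-noncrossing trees with $n$ vertices is $$\frac{1}{n-1}\binom{(2k+1)(n-1)}{n}-\frac{1}{2n-1}\binom{(2k+1)n-k-1}{n}.$$ For every $h\in\{1,\dots,k\}$, the number of $k$-noncrossing trees with $n$ vertices whose root is labelled $h$ is $$\frac{k+1-h}{2kn-k-h+1}\binom{(2k+1)n-k-h-1}{n-1}.$$ -/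

import Mathlib

/-- The `n` points of the unit circle on which the vertices are placed, in circular order. -/
noncomputable def circlePoint (n : ℕ) (i : Fin n) : ℂ :=
  ⟨Real.cos (2 * (Real.pi * (i : ℝ) / n)), Real.sin (2 * (Real.pi * (i : ℝ) / n))⟩

/-- The edges of `G`, drawn as line segments between the points on the circle,
do not meet in interior points. -/
def NoncrossingGraph {n : ℕ} (G : SimpleGraph (Fin n)) : Prop :=
  ∀ a b c d : Fin n, G.Adj a b → G.Adj c d → s(a, b) ≠ s(c, d) →
    Disjoint (openSegment ℝ (circlePoint n a) (circlePoint n b))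
      (openSegment ℝ (circlePoint n c) (circlePoint n d))

/-- `G` with labels `f` is a `k`-noncrossing tree on the vertices `0, …, n - 1`,
with root `0`. -/
structure IsKNoncrossingTree (k n : ℕ) [NeZero n]
    (G : SimpleGraph (Fin n)) (f : Fin n → ℕ) : Prop where
  isTree : G.IsTree
  noncrossing : NoncrossingGraph G
  label_mem : ∀ v, f v ∈ Set.Icc 1 k
  /-- If `i < j` are adjacent and the path from the root to `j` contains `i`, then the labels
  of `i` and `j` add up to at most `k + 1`. -/
  label_add_le : ∀ i j : Fin n, G.Adj i j → i < j →
    (∃ p : G.Walk 0 j, p.IsPath ∧ i ∈ p.support) → f i + f j ≤ k + 1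

/-- The set of `k`-noncrossing trees with `n` vertices. -/
def kNoncrossingTrees (k n : ℕ) [NeZero n] : Set (SimpleGraph (Fin n) × (Fin n → ℕ)) :=
  {T | IsKNoncrossingTree k n T.1 T.2}

/-- The set of `k`-noncrossing trees with `n` vertices whose root is labelled `h`. -/
def kNoncrossingTreesWithRoot (k n h : ℕ) [NeZero n] :
    Set (SimpleGraph (Fin n) × (Fin n → ℕ)) :=
  {T | IsKNoncrossingTree k n T.1 T.2 ∧ T.2 0 = h}

/-- Orientation of a triangle in the plane. -/
def planeOrient (u v w : ℂ) : ℝ :=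
  (u.re * v.im - v.re * u.im) + (v.re * w.im - w.re * v.im) + (w.re * u.im - u.re * w.im)

theorem planeOrient_circlePoint_pos {n : ℕ} {a b c : Fin n} (hab : a < b) (hbc : b < c) :
    0 < planeOrient (circlePoint n a) (circlePoint n b) (circlePoint n c) := by
  have hn : (0 : ℝ) < n := by
    have := a.pos
    exact_mod_cast this
  have key : ∀ x y : Fin n, x < y →
      0 < Real.sin (Real.pi * (y : ℝ) / n - Real.pi * (x : ℝ) / n) := by
    intro x y hxy
    have h1 : ((x : ℕ) : ℝ) < ((y : ℕ) : ℝ) := by exact_mod_cast hxy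
    have h2 : ((y : ℕ) : ℝ) < n := by exact_mod_cast y.2
    have h3 : (0 : ℝ) ≤ ((x : ℕ) : ℝ) := by positivity
    have h4 : Real.pi * (y : ℝ) / n - Real.pi * (x : ℝ) / n
        = Real.pi * (((y : ℝ) - x) / n) := by ring
    have h5 : 0 < ((y : ℝ) - x) / n := div_pos (by linarith) hn
    have h6 : ((y : ℝ) - x) / n < 1 := by rw [div_lt_one hn]; linarith
    rw [h4]
    apply Real.sin_pos_of_pos_of_lt_pi
    · exact mul_pos Real.pi_pos h5
    · nlinarith [Real.pi_pos]
  have k1 := key a b hab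
  have k2 := key b c hbc
  have k3 := key a c (hab.trans hbc)
  simp only [planeOrient, circlePoint]
  generalize Real.pi * ((a : ℕ) : ℝ) / n = A at *
  generalize Real.pi * ((b : ℕ) : ℝ) / n = B at *
  generalize Real.pi * ((c : ℕ) : ℝ) / n = C at *
  have h : 0 < 4 * (Real.sin (B - A) * Real.sin (C - B) * Real.sin (C - A)) := by positivity
  rw [Real.sin_sub, Real.sin_sub, Real.sin_sub] at h
  have eA := Real.sin_sq_add_cos_sq A
  have eB := Real.sin_sq_add_cos_sq B
  have eC := Real.sin_sq_add_cos_sq C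
  simp only [Real.cos_two_mul', Real.sin_two_mul]
  generalize Real.sin A = sa at *
  generalize Real.cos A = ca at *
  generalize Real.sin B = sb at *
  generalize Real.cos B = cb at *
  generalize Real.sin C = sc at *
  generalize Real.cos C = cc at *
  refine lt_of_lt_of_eq h ?_
  linear_combination
    ((cb ^ 2 - sb ^ 2) * (2 * sc * cc) - (cc ^ 2 - sc ^ 2) * (2 * sb * cb)) * eA
    + ((cc ^ 2 - sc ^ 2) * (2 * sa * ca) - (ca ^ 2 - sa ^ 2) * (2 * sc * cc)) * eB
    + ((ca ^ 2 - sa ^ 2) * (2 * sb * cb) - (cb ^ 2 - sb ^ 2) * (2 * sa * ca)) * eC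

theorem planeOrient_rotate (u v w : ℂ) : planeOrient u v w = planeOrient v w u := by
  simp only [planeOrient]; ring

theorem not_disjoint_chords {n : ℕ} {a b c d : Fin n} (hab : a < b) (hbc : b < c) (hcd : c < d) :
    ¬ Disjoint (openSegment ℝ (circlePoint n a) (circlePoint n c))
      (openSegment ℝ (circlePoint n b) (circlePoint n d)) := by
  have h1 := planeOrient_circlePoint_pos hab hbc
  have h2 := planeOrient_circlePoint_pos hab (hbc.trans hcd)
  have h3 := planeOrient_circlePoint_pos (hab.trans hbc) hcd
  have h4 := planeOrient_circlePoint_pos hbc hcd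
  generalize circlePoint n a = p at *
  generalize circlePoint n b = q at *
  generalize circlePoint n c = r at *
  generalize circlePoint n d = s at *
  have e1 : planeOrient q r s + planeOrient p q s
      = planeOrient p r s + planeOrient p q r := by simp only [planeOrient]; ring
  set S := planeOrient q r s + planeOrient p q s with hS
  have hSpos : 0 < S := by positivity
  rw [Set.not_disjoint_iff]
  refine ⟨(planeOrient q r s / S) • p + (planeOrient p q s / S) • r,
    ⟨_, _, by positivity, by positivity, ?_, rfl⟩,
    ⟨planeOrient p r s / S, planeOrient p q r / S, by positivity, by positivity, ?_, ?_⟩⟩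
  · rw [← add_div, ← hS, div_self hSpos.ne']
  · rw [← add_div, ← e1, div_self hSpos.ne']
  · have hre : planeOrient p r s * q.re + planeOrient p q r * s.re
        = planeOrient q r s * p.re + planeOrient p q s * r.re := by
      simp only [planeOrient]; ring
    have him : planeOrient p r s * q.im + planeOrient p q r * s.im
        = planeOrient q r s * p.im + planeOrient p q s * r.im := by
      simp only [planeOrient]; ring
    apply Complex.ext
    · simp only [Complex.add_re, Complex.real_smul, Complex.re_ofReal_mul]
      field_simp
      linarith
    · simp only [Complex.add_im, Complex.real_smul, Complex.im_ofReal_mul]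
      field_simp
      linarith

theorem disjoint_of_planeOrient {p q r s : ℂ} (hr : 0 ≤ planeOrient p q r)
    (hs : 0 ≤ planeOrient p q s) (hne : 0 < planeOrient p q r + planeOrient p q s) :
    Disjoint (openSegment ℝ p q) (openSegment ℝ r s) := by
  rw [Set.disjoint_left]
  rintro z ⟨x, y, -, -, hxy, rfl⟩ ⟨x', y', hx', hy', hxy', he⟩
  have h1 : planeOrient p q (x • p + y • q) = 0 := by
    obtain rfl : x = 1 - y := by linarith
    simp only [planeOrient, Complex.add_re, Complex.add_im, Complex.real_smul,
      Complex.re_ofReal_mul, Complex.im_ofReal_mul]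
    ring
  have h2 : planeOrient p q (x' • r + y' • s)
      = x' * planeOrient p q r + y' * planeOrient p q s := by
    obtain rfl : x' = 1 - y' := by linarith
    simp only [planeOrient, Complex.add_re, Complex.add_im, Complex.real_smul,
      Complex.re_ofReal_mul, Complex.im_ofReal_mul]
    ring
  rw [he, h1] at h2
  rcases hr.lt_or_eq with h | h
  · have := mul_pos hx' h
    have := mul_nonneg hy'.le hs
    linarith
  · have := mul_nonneg hx'.le hr
    have := mul_pos hy' (show 0 < planeOrient p q s by linarith)
    linarith

theorem planeOrient_circlePoint_outside {n : ℕ} {a b x : Fin n} (hab : a < b)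
    (hx : x ≤ a ∨ b ≤ x) :
    0 ≤ planeOrient (circlePoint n a) (circlePoint n b) (circlePoint n x) ∧
      (x ≠ a → x ≠ b → 
        0 < planeOrient (circlePoint n a) (circlePoint n b) (circlePoint n x)) := by
  by_cases h1 : x = a
  · subst h1
    refine ⟨le_of_eq ?_, fun h => absurd rfl h⟩
    simp only [planeOrient]; ring
  by_cases h2 : x = b
  · subst h2
    refine ⟨le_of_eq ?_, fun _ h => absurd rfl h⟩
    simp only [planeOrient]; ring
  have : 0 < planeOrient (circlePoint n a) (circlePoint n b) (circlePoint n x) := by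
    rcases hx with hx | hx
    · rw [← planeOrient_rotate]
      exact planeOrient_circlePoint_pos (lt_of_le_of_ne hx h1) hab
    · exact planeOrient_circlePoint_pos hab (lt_of_le_of_ne hx (Ne.symm h2))
  exact ⟨this.le, fun _ _ => this⟩

theorem planeOrient_circlePoint_inside {n : ℕ} {a b x : Fin n}
    (hx : a ≤ x ∧ x ≤ b) :
    0 ≤ planeOrient (circlePoint n b) (circlePoint n a) (circlePoint n x) ∧
      (x ≠ a → x ≠ b → 
        0 < planeOrient (circlePoint n b) (circlePoint n a) (circlePoint n x)) := by
  by_cases h1 : x = a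
  · subst h1
    refine ⟨le_of_eq ?_, fun h => absurd rfl h⟩
    simp only [planeOrient]; ring
  by_cases h2 : x = b
  · subst h2
    refine ⟨le_of_eq ?_, fun _ h => absurd rfl h⟩
    simp only [planeOrient]; ring
  have : 0 < planeOrient (circlePoint n b) (circlePoint n a) (circlePoint n x) := by
    rw [planeOrient_rotate]
    exact planeOrient_circlePoint_pos (lt_of_le_of_ne hx.1 (Ne.symm h1)) (lt_of_le_of_ne hx.2 h2)
  exact ⟨this.le, fun _ _ => this⟩

theorem disjoint_chords {n : ℕ} {a b c d : Fin n} (hab : a < b) (hcd : c < d)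
    (hne : ¬ (a = c ∧ b = d)) (h1 : ¬ (a < c ∧ c < b ∧ b < d))
    (h2 : ¬ (c < a ∧ a < d ∧ d < b)) :
    Disjoint (openSegment ℝ (circlePoint n a) (circlePoint n b))
      (openSegment ℝ (circlePoint n c) (circlePoint n d)) := by
  have hx : (c ≠ a ∧ c ≠ b) ∨ (d ≠ a ∧ d ≠ b) := by omega
  have hcase : ((a ≤ c ∧ c ≤ b) ∧ (a ≤ d ∧ d ≤ b)) ∨ ((c ≤ a ∨ b ≤ c) ∧ (d ≤ a ∨ b ≤ d)) := by
    omega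
  rcases hcase with ⟨hc, hd⟩ | ⟨hc, hd⟩
  · rw [openSegment_symm]
    have k1 := planeOrient_circlePoint_inside hc
    have k2 := planeOrient_circlePoint_inside hd
    refine disjoint_of_planeOrient k1.1 k2.1 ?_
    rcases hx with hx | hx
    · linarith [k1.2 hx.1 hx.2, k2.1]
    · linarith [k2.2 hx.1 hx.2, k1.1]
  · have k1 := planeOrient_circlePoint_outside hab hc
    have k2 := planeOrient_circlePoint_outside hab hd
    refine disjoint_of_planeOrient k1.1 k2.1 ?_
    rcases hx with hx | hx
    · linarith [k1.2 hx.1 hx.2, k2.1]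
    · linarith [k2.2 hx.1 hx.2, k1.1]

/-- The combinatorial form of the noncrossing condition. -/
theorem noncrossingGraph_iff {n : ℕ} (G : SimpleGraph (Fin n)) :
    NoncrossingGraph G ↔
      ∀ a b c d : Fin n, a < b → b < c → c < d → G.Adj a c → ¬ G.Adj b d := by
  constructor
  · intro h a b c d hab hbc hcd hac hbd
    refine not_disjoint_chords hab hbc hcd (h a c b d hac hbd ?_)
    intro he
    rcases Sym2.eq_iff.1 he with h' | h' <;> omega
  · intro h
    have main : ∀ a b c d : Fin n, a < b → c < d → G.Adj a b → G.Adj c d → s(a, b) ≠ s(c, d) →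
        Disjoint (openSegment ℝ (circlePoint n a) (circlePoint n b))
          (openSegment ℝ (circlePoint n c) (circlePoint n d)) := by
      intro a b c d hab hcd h1 h2 hne
      refine disjoint_chords hab hcd ?_ ?_ ?_
      · rintro ⟨rfl, rfl⟩; exact hne rfl
      · rintro ⟨k1, k2, k3⟩; exact h a c b d k1 k2 k3 h1 h2
      · rintro ⟨k1, k2, k3⟩; exact h c a d b k1 k2 k3 h2 h1
    intro a b c d hab hcd hne
    rcases lt_or_gt_of_ne hab.ne with k | k <;> rcases lt_or_gt_of_ne hcd.ne with l | l
    · exact main a b c d k l hab hcd hne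
    · rw [openSegment_symm ℝ (circlePoint n c)]
      exact main a b d c k l hab hcd.symm (by rwa [Sym2.eq_swap (a := d)])
    · rw [openSegment_symm ℝ (circlePoint n a)]
      exact main b a c d k l hab.symm hcd (by rwa [Sym2.eq_swap (a := b)])
    · rw [openSegment_symm ℝ (circlePoint n a), openSegment_symm ℝ (circlePoint n c)]
      exact main b a d c k l hab.symm hcd.symm
        (by rwa [Sym2.eq_swap (a := b), Sym2.eq_swap (a := d)])

/-!
A noncrossing tree is described by the map that sends each vertex other than the root to its parent.
The condition on the labels then compares every vertex with its parent, when the parent is smaller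
(`exists_isPath_mem_support_iff`). If the root `0` has label `h`, removing it leaves a noncrossing
forest on the interval `[1, n)`, whose vertices hanging from the root have labels at most
`k + 1 - h` (`forestGraph`).

More generally, let `F r` be the generating function, by number of vertices, of the labelled
noncrossing forests on an interval that hang from an outside vertex `ρ` and in which the children of
`ρ` have labels at most `r`; it does not matter where the interval is and on which side of it `ρ`
lies. In a nonempty forest on `[x, y)`, let `c` be the child of `ρ` from which `x` descends, and `j`
its label. Since no edges cross, the descendants of `c` form an interval `[x, e)`, and no edge
passes over `c`. So the forest consists of `c`, of a forest on `[x, c)` hanging from `c`, with no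
condition on the labels at `c` because `c` is the larger vertex, of a forest on `[c + 1, e)` hanging
from `c`, where labels at `c` are at most `k + 1 - j`, and of a forest on `[e, y)` hanging from `ρ`
(`IsForest.exists_eq_glue`, `isForest_glue`, `glue_injective`). Hence, for `r ≤ k`,
`F r = 1 + z * ∑ F k * F (k + 1 - j) * F r`, the sum being over `1 ≤ j ≤ r`.

This system is solved by `F r = B ^ r`, where `B = 1 + z * B ^ (2 * k + 1)`
(`fussCatalan_succ_eq_sum_antidiagonal`), so the forests are counted by the Fuss–Catalan numbers
(`finite_and_card_isForest`). The closed form of the coefficients of `B ^ r` follows by induction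
from `B ^ (r + 1) = B ^ r + z * B ^ (r + 1 + 2 * k)` (`succ_mul_fussCatalan`), and the sum over the
labels of the root telescopes (`sum_fussCatalan_eq`).
-/

/-! ### Fuss–Catalan numbers -/

/-- The coefficient of `z ^ m` in `B ^ r`, where `B` is the power series with
`B = 1 + z * B ^ (2 * k + 1)`. The recursion is the coefficient form of
`B ^ (r + 1) = B ^ r + z * B ^ (r + 1 + 2 * k)`. -/
def fussCatalan (k : ℕ) : ℕ → ℕ → ℕ
  | 0, _ => 1
  | _ + 1, 0 => 0
  | m + 1, r + 1 => fussCatalan k (m + 1) r + fussCatalan k m (r + 1 + 2 * k)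

theorem succ_mul_fussCatalan (k m r : ℕ) :
    (m + 1) * fussCatalan k (m + 1) r = r * ((2 * k + 1) * m + 2 * k + r).choose m := by
  induction m generalizing r with
  | zero =>
    induction r with
    | zero => simp [fussCatalan]
    | succ r ih => simp [fussCatalan] at ih ⊢; omega
  | succ m ihm =>
    induction r with
    | zero => simp [fussCatalan]
    | succ r ihr =>
      have h := ihm (r + 1 + 2 * k)
      obtain ⟨Q, hQ⟩ : ∃ Q, Q = (2 * k + 1) * (m + 1) + 2 * k + r := ⟨_, rfl⟩
      have e1 : (2 * k + 1) * m + 2 * k + (r + 1 + 2 * k) = Q := by rw [hQ]; ring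
      have e2 : (2 * k + 1) * (m + 1) + 2 * k + (r + 1) = Q + 1 := by rw [hQ]; ring
      rw [e1] at h
      rw [← hQ] at ihr
      rw [e2, fussCatalan, Nat.choose_succ_succ]
      have h3 := Nat.choose_succ_right_eq Q m
      obtain ⟨P, hP⟩ : ∃ P, Q = P + m := ⟨2 * k * (m + 2) + r + 1, by rw [hQ]; ring⟩
      rw [show Q - m = P by omega] at h3
      have hP' : P = 2 * k * (m + 2) + r + 1 := by
        have : P + m = 2 * k * (m + 2) + r + 1 + m := by rw [← hP, hQ]; ring
        omega
      refine Nat.eq_of_mul_eq_mul_left (Nat.succ_pos m) ?_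
      generalize Q.choose m = C0 at *
      generalize Q.choose (m + 1) = C1 at *
      generalize fussCatalan k (m + 1 + 1) r = A1 at *
      generalize fussCatalan k (m + 1) _ = A2 at *
      subst hP'
      zify at *
      linear_combination ((m : ℤ) + 1) * ihr + ((m : ℤ) + 2) * h - h3

/-- The coefficient form of `B ^ r * B ^ s = B ^ (r + s)`. -/
theorem coeff_mul_fussCatalan (k m r s : ℕ) :
    PowerSeries.coeff m (PowerSeries.mk (fussCatalan k · r) * PowerSeries.mk (fussCatalan k · s))
      = fussCatalan k m (r + s) := by
  have rec_eq : ∀ r, PowerSeries.mk (fussCatalan k · (r + 1)) =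
      PowerSeries.mk (fussCatalan k · r)
        + PowerSeries.X * PowerSeries.mk (fussCatalan k · (r + 1 + 2 * k)) := by
    intro r
    ext m
    cases m <;> simp [PowerSeries.coeff_succ_X_mul, fussCatalan]
  have zero_eq : PowerSeries.mk (fussCatalan k · 0) = 1 := by
    ext m
    cases m <;> simp [fussCatalan, PowerSeries.coeff_one]
  induction m generalizing r s with
  | zero => simp [PowerSeries.coeff_mul, fussCatalan]
  | succ m ihm =>
    induction r with
    | zero => simp [zero_eq]
    | succ r ihr =>
      rw [rec_eq, add_mul, map_add, ihr, mul_assoc, PowerSeries.coeff_succ_X_mul, ihm,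
        show r + 1 + s = r + s + 1 by ring, fussCatalan,
        show r + 1 + 2 * k + s = r + s + 1 + 2 * k by ring]

theorem fussCatalan_succ_eq_sum (k m r : ℕ) :
    fussCatalan k (m + 1) r = ∑ i ∈ Finset.range r, fussCatalan k m (i + 1 + 2 * k) := by
  induction r with
  | zero => simp [fussCatalan]
  | succ r ih => rw [fussCatalan, Finset.sum_range_succ, ih]

/-- The coefficient form of `B ^ r = 1 + z * ∑ B ^ k * B ^ (k + 1 - j) * B ^ r`, the sum being
over `1 ≤ j ≤ r`. -/
theorem fussCatalan_succ_eq_sum_antidiagonal {k r : ℕ} (hr : r ≤ k) (m : ℕ) :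
    fussCatalan k (m + 1) r =
      ∑ j ∈ Finset.Icc 1 r, ∑ u ∈ Finset.HasAntidiagonal.antidiagonal m,
        ∑ w ∈ Finset.HasAntidiagonal.antidiagonal u.2,
          fussCatalan k u.1 k * (fussCatalan k w.1 (k + 1 - j) * fussCatalan k w.2 r) := by
  have conv : ∀ m r s, ∑ w ∈ Finset.HasAntidiagonal.antidiagonal m,
      fussCatalan k w.1 r * fussCatalan k w.2 s = fussCatalan k m (r + s) := by
    intro m r s
    rw [← coeff_mul_fussCatalan, PowerSeries.coeff_mul]
    simp
  have inner : ∀ j ∈ Finset.Icc 1 r, (∑ u ∈ Finset.HasAntidiagonal.antidiagonal m,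
      ∑ w ∈ Finset.HasAntidiagonal.antidiagonal u.2,
        fussCatalan k u.1 k * (fussCatalan k w.1 (k + 1 - j) * fussCatalan k w.2 r))
      = fussCatalan k m (k + (k + 1 - j + r)) := by
    intro j _
    simp_rw [← Finset.mul_sum, conv]
  rw [Finset.sum_congr rfl inner, fussCatalan_succ_eq_sum]
  refine Finset.sum_nbij' (fun i => r - i) (fun j => r - j) ?_ ?_ ?_ ?_ ?_
  · intro i hi; simp at hi ⊢; omega
  · intro i hi; simp at hi ⊢; omega
  · intro i hi; simp at hi ⊢; omega
  · intro i hi; simp at hi ⊢; omega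
  · intro i hi
    simp at hi ⊢
    congr 1
    omega

/-- The Fuss–Catalan number as it appears in the count of trees with a given root label. -/
theorem fussCatalan_eq_div {k m r : ℕ} (hr : 0 < r) :
    (fussCatalan k (m + 1) r : ℚ) =
      r / (2 * k * (m + 1) + r) * (((2 * k + 1) * m + 2 * k + r).choose (m + 1) : ℕ) := by
  obtain ⟨Q, hQ⟩ : ∃ Q, Q = (2 * k + 1) * m + 2 * k + r := ⟨_, rfl⟩
  have h1 := succ_mul_fussCatalan k m r
  have h2 := Nat.choose_succ_right_eq Q m
  rw [show Q - m = 2 * k * (m + 1) + r by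
    have : Q = 2 * k * (m + 1) + r + m := by rw [hQ]; ring
    omega] at h2
  rw [← hQ] at h1 ⊢
  have hr' : (0 : ℚ) < r := by exact_mod_cast hr
  have hne : (2 * k * (m + 1) + r : ℚ) ≠ 0 := by positivity
  have hm : (m + 1 : ℚ) ≠ 0 := by positivity
  have h1' : ((m : ℚ) + 1) * fussCatalan k (m + 1) r = r * Q.choose m := by exact_mod_cast h1
  have h2' : (Q.choose (m + 1) : ℚ) * (m + 1) = Q.choose m * (2 * k * (m + 1) + r) := by
    exact_mod_cast h2
  rw [div_mul_eq_mul_div, eq_div_iff hne]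
  refine mul_left_cancel₀ hm ?_
  linear_combination (2 * k * (m + 1) + r : ℚ) * h1' - (r : ℚ) * h2'

/-- Summed over `1 ≤ r ≤ s`, the coefficients of `B ^ r` telescope, because
`z * B ^ r = B ^ (r - 2 * k) - B ^ (r - 2 * k - 1)`. -/
theorem sum_fussCatalan_eq (k m s : ℕ) :
    ((m : ℚ) + 2) * ∑ r ∈ Finset.range s, (fussCatalan k (m + 1) (r + 1) : ℚ) =
      ((s : ℚ) - 2 * k) * (((2 * k + 1) * (m + 1) + s).choose (m + 1) : ℕ)
        + 2 * k * (((2 * k + 1) * (m + 1)).choose (m + 1) : ℕ) := by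
  induction s with
  | zero => simp
  | succ s ih =>
    rw [Finset.sum_range_succ, mul_add, ih]
    have h1 := succ_mul_fussCatalan k m (s + 1)
    obtain ⟨Q, hQ⟩ : ∃ Q, Q = (2 * k + 1) * (m + 1) + s := ⟨_, rfl⟩
    rw [show (2 * k + 1) * m + 2 * k + (s + 1) = Q by rw [hQ]; ring] at h1
    rw [← add_assoc ((2 * k + 1) * (m + 1)), ← hQ, Nat.choose_succ_succ]
    have h2 := Nat.choose_succ_right_eq Q m
    rw [show Q - m = 2 * k * (m + 1) + s + 1 by
      have : Q = 2 * k * (m + 1) + s + 1 + m := by rw [hQ]; ring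
      omega] at h2
    have h1' : ((m : ℚ) + 1) * fussCatalan k (m + 1) (s + 1) = (s + 1) * Q.choose m := by
      exact_mod_cast h1
    have h2' : (Q.choose (m + 1) : ℚ) * (m + 1) = Q.choose m * (2 * k * (m + 1) + s + 1) := by
      exact_mod_cast h2
    have hm : (m + 1 : ℚ) ≠ 0 := by positivity
    refine mul_left_cancel₀ hm ?_
    push_cast
    linear_combination ((m : ℚ) + 2) * h1' - h2'

/-! ### Noncrossing forests on an interval -/

/-- A labelled noncrossing forest on the integer interval `[x, y)`, hung from a vertex `ρ` outside
that interval: `(g v).1` is the parent of `v`, which lies in the interval or is `ρ`, and `(g v).2`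
is the label of `v`. The children of `ρ` have labels at most `r`. Cycles are
excluded by a function that decreases from each vertex to its parent. Outside the interval `g` takes
the value `0`, so that `g` is determined by the forest. -/
structure IsForest (k r ρ x y : ℕ) (g : ℕ → ℕ × ℕ) : Prop where
  eq_zero : ∀ v, ¬ (x ≤ v ∧ v < y) → g v = 0
  parent_mem : ∀ v, x ≤ v → v < y → (x ≤ (g v).1 ∧ (g v).1 < y) ∨ (g v).1 = ρ
  exists_depth : ∃ d : ℕ → ℕ, ∀ v, x ≤ v → v < y → d (g v).1 < d v
  noncrossing : ∀ v w, x ≤ v → v < y → x ≤ w → w < y →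
    ¬ (min v (g v).1 < min w (g w).1 ∧ min w (g w).1 < max v (g v).1 ∧
      max v (g v).1 < max w (g w).1)
  one_le_label : ∀ v, x ≤ v → v < y → 1 ≤ (g v).2
  label_le : ∀ v, x ≤ v → v < y → (g v).2 ≤ k
  label_le_of_root : ∀ v, x ≤ v → v < y → (g v).1 = ρ → (g v).2 ≤ r
  label_add_le : ∀ v, x ≤ v → v < y → (g v).1 ≠ ρ → (g v).1 < v →
    (g (g v).1).2 + (g v).2 ≤ k + 1

/-- The forest on `[x, y)` made of a child `c` of `ρ` with label `j`, a forest `g₁` on `[x, c)`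
and a forest `g₂` on `[c + 1, e)`, both hung from `c`, and a forest `g₃` on `[e, y)` hung
from `ρ`. -/
def glue (ρ c e j : ℕ) (g₁ g₂ g₃ : ℕ → ℕ × ℕ) (v : ℕ) : ℕ × ℕ :=
  if v < c then g₁ v else if v = c then (ρ, j) else if v < e then g₂ v else g₃ v

section glue

variable {ρ c e j v : ℕ} {g₁ g₂ g₃ : ℕ → ℕ × ℕ}

theorem glue_of_lt (h : v < c) : glue ρ c e j g₁ g₂ g₃ v = g₁ v := if_pos h

theorem glue_self : glue ρ c e j g₁ g₂ g₃ c = (ρ, j) := by simp [glue]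

theorem glue_of_gt_of_lt (h : c < v) (h' : v < e) : glue ρ c e j g₁ g₂ g₃ v = g₂ v := by
  rw [glue, if_neg (by omega), if_neg (by omega), if_pos h']

theorem glue_of_ge (hce : c < e) (h : e ≤ v) : glue ρ c e j g₁ g₂ g₃ v = g₃ v := by
  rw [glue, if_neg (by omega), if_neg (by omega), if_neg (by omega)]

end glue

theorem isForest_glue {k r ρ x y c e j : ℕ} {g₁ g₂ g₃ : ℕ → ℕ × ℕ}
    (hρ : ρ < x ∨ y ≤ ρ) (hxc : x ≤ c) (hce : c < e) (hey : e ≤ y) (hj : 1 ≤ j) (hjr : j ≤ r)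
    (hrk : r ≤ k) (h₁ : IsForest k k c x c g₁) (h₂ : IsForest k (k + 1 - j) c (c + 1) e g₂)
    (h₃ : IsForest k r ρ e y g₃) : IsForest k r ρ x y (glue ρ c e j g₁ g₂ g₃) := by
  -- the four parts of the interval
  have cases : ∀ v, x ≤ v → v < y →
      (v < c ∧ glue ρ c e j g₁ g₂ g₃ v = g₁ v ∧ x ≤ (g₁ v).1 ∧ (g₁ v).1 ≤ c) ∨
      (v = c ∧ glue ρ c e j g₁ g₂ g₃ v = (ρ, j)) ∨
      (c < v ∧ v < e ∧ glue ρ c e j g₁ g₂ g₃ v = g₂ v ∧ c ≤ (g₂ v).1 ∧ (g₂ v).1 < e) ∨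
      (e ≤ v ∧ glue ρ c e j g₁ g₂ g₃ v = g₃ v ∧
        ((e ≤ (g₃ v).1 ∧ (g₃ v).1 < y) ∨ (g₃ v).1 = ρ)) := by
    intro v hxv hvy
    rcases lt_trichotomy v c with h | rfl | h
    · have := h₁.parent_mem v hxv h
      exact Or.inl ⟨h, glue_of_lt h, by omega⟩
    · exact Or.inr (Or.inl ⟨rfl, glue_self⟩)
    · rcases lt_or_ge v e with h' | h'
      · have := h₂.parent_mem v h h'
        exact Or.inr (Or.inr (Or.inl ⟨h, h', glue_of_gt_of_lt h h', by omega⟩))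
      · exact Or.inr (Or.inr (Or.inr ⟨h', glue_of_ge hce h', h₃.parent_mem v h' hvy⟩))
  refine ⟨?_, ?_, ?_, ?_, ?_, ?_, ?_, ?_⟩
  · intro v hv
    rcases lt_or_ge v c with h | h
    · rw [glue_of_lt h, h₁.eq_zero v (by omega)]
    · rw [glue_of_ge hce (by omega), h₃.eq_zero v (by omega)]
  · intro v hxv hvy
    rcases cases v hxv hvy with ⟨h, hg, h'⟩ | ⟨rfl, hg⟩ | ⟨h, h', hg, h''⟩ | ⟨h, hg, h'⟩ <;>
      rw [hg] <;> omega
  · obtain ⟨d₁, hd₁⟩ := h₁.exists_depth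
    obtain ⟨d₂, hd₂⟩ := h₂.exists_depth
    obtain ⟨d₃, hd₃⟩ := h₃.exists_depth
    -- the depth of `c` exceeds that of `ρ` by one; depths in the parts hanging from `c` are shifted
    refine ⟨fun v => if x ≤ v ∧ v < c then d₁ v + d₃ ρ + 2 else if v = c then d₃ ρ + 1 else
      if c < v ∧ v < e then d₂ v + d₃ ρ + 2 else d₃ v, fun v hxv hvy => ?_⟩
    rcases cases v hxv hvy with ⟨h, hg, h'⟩ | ⟨rfl, hg⟩ | ⟨h, h', hg, h''⟩ | ⟨h, hg, h'⟩ <;>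
      simp only [hg]
    · have := hd₁ v hxv h
      split_ifs <;> omega
    · split_ifs <;> omega
    · have := hd₂ v h h'
      split_ifs <;> omega
    · have := hd₃ v h hvy
      split_ifs <;> omega
  · intro v w hxv hvy hxw hwy
    rcases cases v hxv hvy with ⟨hv, hg, hv'⟩ | ⟨rfl, hg⟩ | ⟨hv, hv', hg, hv''⟩ | ⟨hv, hg, hv'⟩ <;>
    rcases cases w hxw hwy with ⟨hw, hg', hw'⟩ | ⟨rfl, hg'⟩ | ⟨hw, hw', hg', hw''⟩ |
      ⟨hw, hg', hw'⟩ <;>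
    simp only [hg, hg'] <;>
    first
    | exact h₁.noncrossing v w hxv hv hxw hw
    | exact h₂.noncrossing v w hv hv' hw hw'
    | exact h₃.noncrossing v w hv hvy hw hwy
    | omega
  · intro v hxv hvy
    rcases cases v hxv hvy with ⟨h, hg, h'⟩ | ⟨rfl, hg⟩ | ⟨h, h', hg, h''⟩ | ⟨h, hg, h'⟩ <;> rw [hg]
    · exact h₁.one_le_label v hxv h
    · exact hj
    · exact h₂.one_le_label v h h'
    · exact h₃.one_le_label v h hvy
  · intro v hxv hvy
    rcases cases v hxv hvy with ⟨h, hg, h'⟩ | ⟨rfl, hg⟩ | ⟨h, h', hg, h''⟩ | ⟨h, hg, h'⟩ <;> rw [hg]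
    · exact h₁.label_le v hxv h
    · exact hjr.trans hrk
    · exact h₂.label_le v h h'
    · exact h₃.label_le v h hvy
  · intro v hxv hvy
    rcases cases v hxv hvy with ⟨h, hg, h'⟩ | ⟨rfl, hg⟩ | ⟨h, h', hg, h''⟩ | ⟨h, hg, h'⟩ <;> rw [hg]
    · omega
    · exact fun _ => hjr
    · omega
    · exact h₃.label_le_of_root v h hvy
  · intro v hxv hvy
    rcases cases v hxv hvy with ⟨h, hg, h'⟩ | ⟨rfl, hg⟩ | ⟨h, h', hg, h''⟩ | ⟨h, hg, h'⟩ <;> rw [hg]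
    · intro _ hlt
      rw [glue_of_lt (by omega)]
      exact h₁.label_add_le v hxv h (by omega) hlt
    · exact fun h => absurd rfl h
    · intro _ hlt
      by_cases hc : (g₂ v).1 = c
      · have := h₂.label_le_of_root v h h' hc
        rw [hc, glue_self]
        simp only
        omega
      · rw [glue_of_gt_of_lt (by omega) (by omega)]
        exact h₂.label_add_le v h h' hc hlt
    · intro hne hlt
      rw [glue_of_ge hce (by omega)]
      exact h₃.label_add_le v h hvy hne hlt

/-- The map `g` on `[a, b)`, and `0` elsewhere. -/
def restrictIco (a b : ℕ) (g : ℕ → ℕ × ℕ) (v : ℕ) : ℕ × ℕ := if a ≤ v ∧ v < b then g v else 0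

theorem restrictIco_of_mem {a b v : ℕ} {g : ℕ → ℕ × ℕ} (h : a ≤ v) (h' : v < b) :
    restrictIco a b g v = g v := if_pos ⟨h, h'⟩

/-- The vertex `v` is `c`, or `c` is reached from it by taking parents, without taking the parent of
a vertex outside `[x, y)`, where the value of `g` has no meaning. -/
def IsDescendant (g : ℕ → ℕ × ℕ) (x y c v : ℕ) : Prop :=
  Relation.ReflTransGen (fun u w => (x ≤ u ∧ u < y) ∧ (g u).1 = w) v c

namespace IsForest

variable {k r ρ x y : ℕ} {g : ℕ → ℕ × ℕ}

/-- Every vertex of a forest descends from a child of the root. -/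
theorem exists_child (h : IsForest k r ρ x y g) {v : ℕ} (hxv : x ≤ v) (hvy : v < y) :
    ∃ c, x ≤ c ∧ c < y ∧ (g c).1 = ρ ∧ IsDescendant g x y c v := by
  obtain ⟨d, hd⟩ := h.exists_depth
  induction hn : d v using Nat.strong_induction_on generalizing v with
  | _ n ih =>
    by_cases hv : (g v).1 = ρ
    · exact ⟨v, hxv, hvy, hv, Relation.ReflTransGen.refl⟩
    · obtain ⟨h₁, h₂⟩ := (h.parent_mem v hxv hvy).resolve_right hv
      obtain ⟨c, hc, hc', hc'', hvc⟩ := ih _ (hn ▸ hd v hxv hvy) h₁ h₂ rfl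
      exact ⟨c, hc, hc', hc'', hvc.head ⟨⟨hxv, hvy⟩, rfl⟩⟩

theorem not_isDescendant_root (hρ : ρ < x ∨ y ≤ ρ) {c : ℕ} (hc : x ≤ c ∧ c < y) :
    ¬ IsDescendant g x y c ρ := by
  intro hd
  rcases Relation.ReflTransGen.cases_head hd with h | ⟨_, h, _⟩ <;> omega

/-- A vertex descends from at most one child of the root. -/
theorem child_unique (hρ : ρ < x ∨ y ≤ ρ) {v c c' : ℕ} (hc : x ≤ c ∧ c < y) (hc' : x ≤ c' ∧ c' < y)
    (hgc : (g c).1 = ρ) (hgc' : (g c').1 = ρ) (hv : IsDescendant g x y c v)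
    (hv' : IsDescendant g x y c' v) : c = c' := by
  induction hv using Relation.ReflTransGen.head_induction_on with
  | refl =>
    rcases Relation.ReflTransGen.cases_head hv' with h | ⟨w, ⟨_, rfl⟩, hw⟩
    · exact h
    · exact absurd (hgc ▸ hw) (not_isDescendant_root hρ hc')
  | head hvw hwc ih =>
    rcases Relation.ReflTransGen.cases_head hv' with rfl | ⟨w, hw, hw'⟩
    · rw [hgc'] at hvw
      exact absurd (hvw.2 ▸ hwc) (not_isDescendant_root hρ hc)
    · exact ih (hvw.2 ▸ hw.2 ▸ hw')

/-- If the edge from `t` to its parent spans `w`, and `t` descends from `c`, then so does `w`: the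
path from `w` to the root has to leave the region below that edge, hence meets one of its ends. -/
theorem isDescendant_of_between (h : IsForest k r ρ x y g) {c t w : ℕ}
    (htx : x ≤ t) (hty : t < y) (hpx : x ≤ (g t).1) (hpy : (g t).1 < y)
    (hp : IsDescendant g x y c (g t).1)
    (hw : min t (g t).1 < w) (hw' : w < max t (g t).1) : IsDescendant g x y c w := by
  have ht : IsDescendant g x y c t := hp.head ⟨⟨htx, hty⟩, rfl⟩
  obtain ⟨d, hd⟩ := h.exists_depth
  induction hn : d w using Nat.strong_induction_on generalizing w with
  | _ n ih =>
    have hxw : x ≤ w := by omega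
    have hwy : w < y := by omega
    have h₁ := h.noncrossing t w htx hty hxw hwy
    have h₂ := h.noncrossing w t hxw hwy htx hty
    have hlt := hd w hxw hwy
    refine Relation.ReflTransGen.head ⟨⟨hxw, hwy⟩, rfl⟩ ?_
    by_cases e₁ : (g w).1 = t
    · rwa [e₁]
    by_cases e₂ : (g w).1 = (g t).1
    · rwa [e₂]
    refine ih _ (hn ▸ hlt) ?_ ?_ rfl <;> omega

/-- The descendants of a child of the root form an interval. -/
theorem isDescendant_of_mem_interval (h : IsForest k r ρ x y g) (hρ : ρ < x ∨ y ≤ ρ) {c v w : ℕ}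
    (hc : x ≤ c ∧ c < y) (hgc : (g c).1 = ρ) (hv : IsDescendant g x y c v)
    (hw : min v c ≤ w) (hw' : w ≤ max v c) : IsDescendant g x y c w := by
  induction hv using Relation.ReflTransGen.head_induction_on with
  | refl =>
    obtain rfl : w = c := by omega
    exact Relation.ReflTransGen.refl
  | head hvu huc ih =>
    rename_i v u
    obtain ⟨hvx, hvu⟩ := hvu
    by_cases h₁ : min u c ≤ w ∧ w ≤ max u c
    · exact ih h₁.1 h₁.2
    by_cases h₂ : w = v
    · subst h₂
      exact huc.head ⟨hvx, hvu⟩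
    have hu : x ≤ u ∧ u < y := by
      rcases h.parent_mem v hvx.1 hvx.2 with h' | h'
      · rwa [hvu] at h'
      · rw [hvu] at h'
        exact absurd (h' ▸ huc) (not_isDescendant_root hρ hc)
    subst hvu
    exact isDescendant_of_between h hvx.1 hvx.2 hu.1 hu.2 huc (by omega) (by omega)

/-- A part of a forest closed under taking parents, up to a new root `σ`, is a forest. -/
theorem restrict (h : IsForest k r ρ x y g) {a b σ s : ℕ} (hxa : x ≤ a) (hby : b ≤ y)
    (hmem : ∀ v, a ≤ v → v < b → (a ≤ (g v).1 ∧ (g v).1 < b) ∨ (g v).1 = σ)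
    (hs : ∀ v, a ≤ v → v < b → (g v).1 = σ → (g v).2 ≤ s) (hρ : ρ < x ∨ y ≤ ρ) :
    IsForest k s σ a b (restrictIco a b g) := by
  have eq : ∀ {v}, a ≤ v → v < b → restrictIco a b g v = g v := restrictIco_of_mem
  refine ⟨fun v hv => if_neg hv, ?_, ?_, ?_, ?_, ?_, ?_, ?_⟩
  · intro v hv hv'
    rw [eq hv hv']
    exact hmem v hv hv'
  · obtain ⟨d, hd⟩ := h.exists_depth
    refine ⟨d, fun v hv hv' => ?_⟩
    rw [eq hv hv']
    exact hd v (by omega) (by omega)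
  · intro v w hv hv' hw hw'
    rw [eq hv hv', eq hw hw']
    exact h.noncrossing v w (by omega) (by omega) (by omega) (by omega)
  · intro v hv hv'
    rw [eq hv hv']
    exact h.one_le_label v (by omega) (by omega)
  · intro v hv hv'
    rw [eq hv hv']
    exact h.label_le v (by omega) (by omega)
  · intro v hv hv'
    rw [eq hv hv']
    exact hs v hv hv'
  · intro v hv hv'
    rw [eq hv hv']
    intro hne hlt
    have := (hmem v hv hv').resolve_right hne
    rw [eq this.1 this.2]
    exact h.label_add_le v (by omega) (by omega) (by omega) hlt

/-- Every nonempty forest is glued from three smaller ones: `c` is the child of the root from which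
the first vertex `x` descends, and `[x, e)` is the set of descendants of `c`. -/
theorem exists_eq_glue (h : IsForest k r ρ x y g) (hρ : ρ < x ∨ y ≤ ρ) (hxy : x < y) :
    ∃ c e j g₁ g₂ g₃, x ≤ c ∧ c < e ∧ e ≤ y ∧ 1 ≤ j ∧ j ≤ r ∧ IsForest k k c x c g₁ ∧
      IsForest k (k + 1 - j) c (c + 1) e g₂ ∧ IsForest k r ρ e y g₃ ∧
      g = glue ρ c e j g₁ g₂ g₃ := by
  obtain ⟨c, hxc, hcy, hgc, hxd⟩ := h.exists_child le_rfl hxy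
  have hcc : IsDescendant g x y c c := Relation.ReflTransGen.refl
  have interval : ∀ v w, IsDescendant g x y c v → x ≤ w → w ≤ v → IsDescendant g x y c w := by
    intro v w hv hxw hwv
    rcases le_total w c with hwc | hwc
    · exact h.isDescendant_of_mem_interval hρ ⟨hxc, hcy⟩ hgc hxd (by omega) (by omega)
    · exact h.isDescendant_of_mem_interval hρ ⟨hxc, hcy⟩ hgc hv (by omega) (by omega)
  -- `e` is the first vertex that does not descend from `c`, or `y`
  obtain ⟨e, hce, hey, he⟩ : ∃ e, c < e ∧ e ≤ y ∧
      ∀ v, x ≤ v → v < y → (IsDescendant g x y c v ↔ v < e) := by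
    by_cases hall : ∀ v, x ≤ v → v < y → IsDescendant g x y c v
    · exact ⟨y, hcy, le_rfl, fun v h₁ h₂ => iff_of_true (hall v h₁ h₂) h₂⟩
    · classical
      have hex : ∃ v, x ≤ v ∧ v < y ∧ ¬ IsDescendant g x y c v := by simpa using hall
      obtain ⟨f₁, f₂, f₃⟩ := Nat.find_spec hex
      refine ⟨Nat.find hex, ?_, f₂.le, fun v h₁ h₂ => ⟨fun hv => ?_, fun hv => ?_⟩⟩
      · by_contra hlt
        exact f₃ (interval c _ hcc f₁ (by omega))
      · by_contra hlt
        exact f₃ (interval v _ hv f₁ (by omega))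
      · by_contra hnd
        exact Nat.find_min hex hv ⟨h₁, h₂, hnd⟩
  have parent_mem : ∀ v, x ≤ v → v < e → v ≠ c → x ≤ (g v).1 ∧ (g v).1 < e := by
    intro v hxv hve hvc
    have hv := (he v hxv (by omega)).2 hve
    rcases Relation.ReflTransGen.cases_head hv with h' | ⟨w, ⟨_, rfl⟩, hw⟩
    · exact absurd h' hvc
    · rcases h.parent_mem v hxv (by omega) with h' | h'
      · exact ⟨h'.1, (he _ h'.1 h'.2).1 hw⟩
      · exact absurd (h' ▸ hw) (not_isDescendant_root hρ ⟨hxc, hcy⟩)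
  -- no edge passes over `c`, because it would cross the edge from `c` to `ρ`
  have nc : ∀ v, x ≤ v → v < y → _ := fun v h₁ h₂ =>
    And.intro (h.noncrossing c v hxc hcy h₁ h₂) (h.noncrossing v c h₁ h₂ hxc hcy)
  simp only [hgc] at nc
  refine ⟨c, e, (g c).2, restrictIco x c g, restrictIco (c + 1) e g, restrictIco e y g, hxc, hce,
    hey, h.one_le_label c hxc hcy, h.label_le_of_root c hxc hcy hgc, ?_, ?_, ?_, ?_⟩
  · refine h.restrict le_rfl hcy.le ?_ ?_ hρ
    · intro v h₁ h₂
      have := parent_mem v h₁ (by omega) (by omega)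
      have := nc v h₁ (by omega)
      omega
    · exact fun v h₁ h₂ _ => h.label_le v h₁ (by omega)
  · refine h.restrict (by omega) hey ?_ ?_ hρ
    · intro v h₁ h₂
      have := parent_mem v (by omega) h₂ (by omega)
      have := nc v (by omega) (by omega)
      omega
    · intro v h₁ h₂ hv
      have := h.label_add_le v (by omega) (by omega) (by omega) (by omega)
      rw [hv] at this
      omega
  · refine h.restrict (by omega) le_rfl ?_ ?_ hρ
    · intro v h₁ h₂
      rcases h.parent_mem v (by omega) h₂ with h' | h'
      · refine Or.inl ⟨?_, h'.2⟩
        by_contra hlt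
        have := (he v (by omega) h₂).1
          (((he _ h'.1 h'.2).2 (by omega)).head ⟨⟨by omega, h₂⟩, rfl⟩)
        omega
      · exact Or.inr h'
    · exact fun v h₁ h₂ hv => h.label_le_of_root v (by omega) h₂ hv
  · funext v
    rcases lt_trichotomy v c with hv | rfl | hv
    · rw [glue_of_lt hv]
      by_cases hxv : x ≤ v
      · rw [restrictIco_of_mem hxv hv]
      · rw [h.eq_zero v (by omega), restrictIco, if_neg (by omega)]
    · rw [glue_self, ← hgc]
    · rcases lt_or_ge v e with hv' | hv'
      · rw [glue_of_gt_of_lt hv hv', restrictIco_of_mem hv hv']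
      · rw [glue_of_ge hce hv']
        by_cases hvy : v < y
        · rw [restrictIco_of_mem hv' hvy]
        · rw [h.eq_zero v (by omega), restrictIco, if_neg (by omega)]

/-- In a glued forest, the vertices that descend from `c` are those before `e`. -/
theorem isDescendant_glue_iff {c e j : ℕ} {g₁ g₂ g₃ : ℕ → ℕ × ℕ}
    (hρ : ρ < x ∨ y ≤ ρ) (hxc : x ≤ c) (hce : c < e) (hey : e ≤ y)
    (h₁ : IsForest k k c x c g₁) (h₂ : IsForest k (k + 1 - j) c (c + 1) e g₂)
    (h₃ : IsForest k r ρ e y g₃) {v : ℕ} (hxv : x ≤ v) (hvy : v < y) :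
    IsDescendant (glue ρ c e j g₁ g₂ g₃) x y c v ↔ v < e := by
  constructor
  · intro hv
    by_contra hlt
    induction hv using Relation.ReflTransGen.head_induction_on with
    | refl => omega
    | head hvu huc ih =>
      rename_i v u
      obtain ⟨hvx, hvu⟩ := hvu
      rw [glue_of_ge hce (by omega)] at hvu
      rcases h₃.parent_mem v (by omega) hvy with h' | h'
      · exact ih (by omega) (by omega) (by omega)
      · exact absurd ((hvu.symm.trans h') ▸ huc) (not_isDescendant_root hρ ⟨hxc, by omega⟩)
  · intro hve
    rcases lt_trichotomy v c with hv | rfl | hv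
    · obtain ⟨d, hd⟩ := h₁.exists_depth
      induction hn : d v using Nat.strong_induction_on generalizing v with
      | _ n ih =>
        refine Relation.ReflTransGen.head ⟨⟨hxv, hvy⟩, rfl⟩ ?_
        rw [glue_of_lt hv]
        rcases h₁.parent_mem v hxv hv with h' | h'
        · exact ih _ (hn ▸ hd v hxv hv) h'.1 (by omega) (by omega) h'.2 rfl
        · rw [h']
    · exact Relation.ReflTransGen.refl
    · obtain ⟨d, hd⟩ := h₂.exists_depth
      induction hn : d v using Nat.strong_induction_on generalizing v with
      | _ n ih =>
        refine Relation.ReflTransGen.head ⟨⟨hxv, hvy⟩, rfl⟩ ?_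
        rw [glue_of_gt_of_lt hv hve]
        rcases h₂.parent_mem v hv hve with h' | h'
        · exact ih _ (hn ▸ hd v hv hve) (by omega) (by omega) h'.2 h'.1 rfl
        · rw [h']

end IsForest

/-- The data of a glued forest is determined by the forest. -/
theorem glue_injective {k r ρ x y c e j c' e' j' : ℕ} {g₁ g₂ g₃ g₁' g₂' g₃' : ℕ → ℕ × ℕ}
    (hρ : ρ < x ∨ y ≤ ρ) (hxc : x ≤ c) (hce : c < e) (hey : e ≤ y)
    (h₁ : IsForest k k c x c g₁) (h₂ : IsForest k (k + 1 - j) c (c + 1) e g₂)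
    (h₃ : IsForest k r ρ e y g₃) (hxc' : x ≤ c') (hce' : c' < e') (hey' : e' ≤ y)
    (h₁' : IsForest k k c' x c' g₁') (h₂' : IsForest k (k + 1 - j') c' (c' + 1) e' g₂')
    (h₃' : IsForest k r ρ e' y g₃') (heq : glue ρ c e j g₁ g₂ g₃ = glue ρ c' e' j' g₁' g₂' g₃') :
    c = c' ∧ e = e' ∧ j = j' ∧ g₁ = g₁' ∧ g₂ = g₂' ∧ g₃ = g₃' := by
  have d := fun v (hxv : x ≤ v) (hvy : v < y) =>
    IsForest.isDescendant_glue_iff hρ hxc hce hey h₁ h₂ h₃ hxv hvy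
  have d' := fun v (hxv : x ≤ v) (hvy : v < y) =>
    IsForest.isDescendant_glue_iff hρ hxc' hce' hey' h₁' h₂' h₃' hxv hvy
  rw [← heq] at d'
  obtain rfl : c = c' := by
    refine IsForest.child_unique (g := glue ρ c e j g₁ g₂ g₃) (v := x) hρ ⟨hxc, by omega⟩
      ⟨hxc', by omega⟩ ?_ ?_ ((d x le_rfl (by omega)).2 (by omega))
      ((d' x le_rfl (by omega)).2 (by omega))
    · rw [glue_self]
    · rw [heq, glue_self]
  obtain rfl : e = e' := by
    rcases lt_trichotomy e e' with h | h | h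
    · have := (d e (by omega) (by omega)).symm.trans (d' e (by omega) (by omega))
      omega
    · exact h
    · have := (d e' (by omega) (by omega)).symm.trans (d' e' (by omega) (by omega))
      omega
  refine ⟨rfl, rfl, ?_, ?_, ?_, ?_⟩
  · have := congrFun heq c
    rw [glue_self, glue_self] at this
    exact congrArg Prod.snd this
  · funext v
    by_cases hv : v < c
    · have := congrFun heq v
      rwa [glue_of_lt hv, glue_of_lt hv] at this
    · rw [h₁.eq_zero v (by omega), h₁'.eq_zero v (by omega)]
  · funext v
    by_cases hv : c < v ∧ v < e
    · have := congrFun heq v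
      rwa [glue_of_gt_of_lt hv.1 hv.2, glue_of_gt_of_lt hv.1 hv.2] at this
    · rw [h₂.eq_zero v (by omega), h₂'.eq_zero v (by omega)]
  · funext v
    by_cases hv : e ≤ v
    · have := congrFun heq v
      rwa [glue_of_ge hce hv, glue_of_ge hce hv] at this
    · rw [h₃.eq_zero v (by omega), h₃'.eq_zero v (by omega)]

theorem isForest_empty_iff {k r ρ x : ℕ} {g : ℕ → ℕ × ℕ} : IsForest k r ρ x x g ↔ g = 0 := by
  constructor
  · exact fun h => funext fun v => h.eq_zero v (by omega)
  · rintro rfl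
    refine ⟨fun _ _ => rfl, ?_, ⟨id, ?_⟩, ?_, ?_, ?_, ?_, ?_⟩ <;> intros <;> omega

/-- The data `(j, ⟨(m₁, m'), (m₂, m₃)⟩)` that occur when a forest with `m + 1` vertices is split:
the label `j` of `c`, and the numbers `m₁`, `m₂`, `m₃` of vertices of the three parts, with
`m' = m₂ + m₃` and `m₁ + m' = m`. -/
def splitIndex (r m : ℕ) : Finset (ℕ × (_ : ℕ × ℕ) × ℕ × ℕ) :=
  Finset.Icc 1 r ×ˢ (Finset.HasAntidiagonal.antidiagonal m).sigma
    fun u => Finset.HasAntidiagonal.antidiagonal u.2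

/-- The number of forests on `m` vertices is the coefficient of `z ^ m` in `B ^ r`, wherever the
interval and the root are. -/
theorem finite_and_card_isForest {k : ℕ} (m : ℕ) : ∀ {r ρ x : ℕ}, r ≤ k → (ρ < x ∨ x + m ≤ ρ) →
    Finite {g // IsForest k r ρ x (x + m) g} ∧
      Nat.card {g // IsForest k r ρ x (x + m) g} = fussCatalan k m r := by
  induction m using Nat.strong_induction_on with
  | _ m ih =>
    intro r ρ x hrk hρ
    rcases m with _ | m
    · simp only [add_zero, isForest_empty_iff]
      exact ⟨inferInstance, by simp [fussCatalan]⟩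
    let F : splitIndex r m → Type := fun i =>
      {g // IsForest k k (x + i.1.2.1.1) x (x + i.1.2.1.1) g} ×
      {g // IsForest k (k + 1 - i.1.1) (x + i.1.2.1.1) (x + i.1.2.1.1 + 1)
        (x + i.1.2.1.1 + 1 + i.1.2.2.1) g} ×
      {g // IsForest k r ρ (x + i.1.2.1.1 + 1 + i.1.2.2.1)
        (x + i.1.2.1.1 + 1 + i.1.2.2.1 + i.1.2.2.2) g}
    have hmem : ∀ i : splitIndex r m, (1 ≤ i.1.1 ∧ i.1.1 ≤ r) ∧ i.1.2.1.1 + i.1.2.1.2 = m ∧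
        i.1.2.2.1 + i.1.2.2.2 = i.1.2.1.2 := by
      rintro ⟨i, hi⟩
      simpa [splitIndex] using hi
    have hF : ∀ i, Finite (F i) ∧ Nat.card (F i) = fussCatalan k i.1.2.1.1 k *
        (fussCatalan k i.1.2.2.1 (k + 1 - i.1.1) * fussCatalan k i.1.2.2.2 r) := by
      intro i
      have hi := hmem i
      obtain ⟨f₁, c₁⟩ := ih i.1.2.1.1 (by omega) (r := k) (ρ := x + i.1.2.1.1) (x := x) le_rfl
        (by omega)
      obtain ⟨f₂, c₂⟩ := ih i.1.2.2.1 (by omega) (r := k + 1 - i.1.1) (ρ := x + i.1.2.1.1)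
        (x := x + i.1.2.1.1 + 1) (by omega) (by omega)
      obtain ⟨f₃, c₃⟩ := ih i.1.2.2.2 (by omega) (r := r) (ρ := ρ)
        (x := x + i.1.2.1.1 + 1 + i.1.2.2.1) hrk (by omega)
      exact ⟨inferInstance, by rw [Nat.card_prod, Nat.card_prod, c₁, c₂, c₃]⟩
    have hy : ∀ i : splitIndex r m, x + i.1.2.1.1 + 1 + i.1.2.2.1 + i.1.2.2.2 = x + (m + 1) := by
      intro i
      have hi := hmem i
      omega
    let Φ : (Σ i, F i) → {g // IsForest k r ρ x (x + (m + 1)) g} := fun s =>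
      ⟨glue ρ (x + s.1.1.2.1.1) (x + s.1.1.2.1.1 + 1 + s.1.1.2.2.1) s.1.1.1
        s.2.1.1 s.2.2.1.1 s.2.2.2.1,
        have hi := hmem s.1
        isForest_glue hρ (by omega) (by omega) (by omega) hi.1.1 hi.1.2 hrk s.2.1.2 s.2.2.1.2
          (hy s.1 ▸ s.2.2.2.2)⟩
    have hΦ : Function.Bijective Φ := by
      constructor
      · rintro ⟨⟨⟨j, ⟨a, b⟩, a', b'⟩, hi⟩, ⟨g₁, h₁⟩, ⟨g₂, h₂⟩, ⟨g₃, h₃⟩⟩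
          ⟨⟨⟨j', ⟨p, q⟩, p', q'⟩, hi'⟩, ⟨g₁', h₁'⟩, ⟨g₂', h₂'⟩, ⟨g₃', h₃'⟩⟩ heq
        have e₁ := hmem ⟨_, hi⟩
        have e₁' := hmem ⟨_, hi'⟩
        have e₂ := hy ⟨_, hi⟩
        have e₂' := hy ⟨_, hi'⟩
        simp only [Φ, Subtype.mk.injEq] at heq e₁ e₁' e₂ e₂' h₁ h₂ h₃ h₁' h₂' h₃'
        have h₄ := h₃
        have h₄' := h₃'
        rw [e₂] at h₄
        rw [e₂'] at h₄'
        obtain ⟨k₁, k₂, k₃, k₄, k₅, k₆⟩ := glue_injective hρ (by omega) (by omega) (by omega) h₁ h₂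
          h₄ (by omega) (by omega) (by omega) h₁' h₂' h₄' heq
        obtain rfl : a = p := by omega
        obtain rfl : b = q := by omega
        obtain rfl : a' = p' := by omega
        obtain rfl : b' = q' := by omega
        subst k₃ k₄ k₅ k₆
        rfl
      · rintro ⟨g, hg⟩
        obtain ⟨c, e, j, g₁, g₂, g₃, hxc, hce, hey, hj, hjr, h₁, h₂, h₃, rfl⟩ :=
          hg.exists_eq_glue hρ (by omega)
        obtain ⟨a, rfl⟩ := Nat.exists_eq_add_of_le hxc
        obtain ⟨p, rfl⟩ := Nat.exists_eq_add_of_le (Nat.succ_le_of_lt hce)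
        obtain ⟨q, hq⟩ := Nat.exists_eq_add_of_le hey
        rw [Nat.succ_eq_add_one] at *
        rw [hq] at h₃
        exact ⟨⟨⟨(j, ⟨(a, p + q), (p, q)⟩), by simp [splitIndex]; omega⟩,
          ⟨g₁, h₁⟩, ⟨g₂, h₂⟩, ⟨g₃, h₃⟩⟩, rfl⟩
    have := fun i => (hF i).1
    refine ⟨Finite.of_surjective Φ hΦ.2, ?_⟩
    rw [← Nat.card_congr (Equiv.ofBijective Φ hΦ), Nat.card_sigma,
      fussCatalan_succ_eq_sum_antidiagonal hrk, Finset.sum_congr rfl fun i _ => (hF i).2]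
    rw [Finset.sum_coe_sort (splitIndex r m) fun i => fussCatalan k i.2.1.1 k *
        (fussCatalan k i.2.2.1 (k + 1 - i.1) * fussCatalan k i.2.2.2 r), splitIndex,
      Finset.sum_product]
    simp_rw [Finset.sum_sigma]

/-! ### Trees and parent maps -/

/-- The graph that joins every vertex other than the root `r` to its parent. -/
def parentGraph {V : Type*} (r : V) (p : V → V) : SimpleGraph V :=
  SimpleGraph.fromRel fun u v => u ≠ r ∧ p u = v

section parentGraph

variable {V : Type*} {r : V} {p : V → V} {d : V → ℕ}

theorem parentGraph_adj {u v : V} :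
    (parentGraph r p).Adj u v ↔ u ≠ v ∧ ((u ≠ r ∧ p u = v) ∨ (v ≠ r ∧ p v = u)) := Iff.rfl

theorem parentGraph_adj_parent (hd : ∀ v, v ≠ r → d (p v) < d v) {v : V} (hv : v ≠ r) :
    (parentGraph r p).Adj (p v) v :=
  ⟨fun h => absurd (hd v hv) (by rw [h]; exact lt_irrefl _), Or.inr ⟨hv, rfl⟩⟩

/-- Following the parents from `v` to the root gives a path. -/
theorem exists_isPath_parentGraph (hd : ∀ v, v ≠ r → d (p v) < d v) (v : V) :
    ∃ q : (parentGraph r p).Walk r v, q.IsPath ∧ (∀ u ∈ q.support, u ≠ v → d u < d v) ∧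
      (v ≠ r → p v ∈ q.support) := by
  induction hn : d v using Nat.strong_induction_on generalizing v with
  | _ n ih =>
    by_cases hv : v = r
    · subst hv
      exact ⟨SimpleGraph.Walk.nil, by simp⟩
    · obtain ⟨q, hq, hq', -⟩ := ih _ (hn ▸ hd v hv) (p v) rfl
      have hlt : ∀ u ∈ q.support, d u < d v := by
        intro u hu
        by_cases h : u = p v
        · exact h ▸ hd v hv
        · exact (hq' u hu h).trans (hd v hv)
      refine ⟨q.concat (parentGraph_adj_parent hd hv),
        hq.concat (fun h => lt_irrefl _ (hlt v h)) _, ?_, ?_⟩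
      · intro u hu huv
        rw [SimpleGraph.Walk.support_concat] at hu
        simp only [List.mem_append, List.mem_singleton] at hu
        exact hn ▸ hlt u (hu.resolve_right huv)
      · intro _
        exact q.support_subset_support_concat _ q.end_mem_support

theorem parentGraph_isTree [Finite V] (hd : ∀ v, v ≠ r → d (p v) < d v) :
    (parentGraph r p).IsTree := by
  have hconn : (parentGraph r p).Connected := by
    have : Nonempty V := ⟨r⟩
    rw [SimpleGraph.connected_iff_exists_forall_reachable]
    exact ⟨r, fun v => (exists_isPath_parentGraph hd v).choose.reachable⟩
  refine SimpleGraph.isTree_iff_connected_and_card.2 ⟨hconn, le_antisymm ?_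
    hconn.card_vert_le_card_edgeSet_add_one⟩
  -- every edge joins a vertex other than the root to its parent
  have hsub : (parentGraph r p).edgeSet ⊆ (fun v => s(v, p v)) '' {r}ᶜ := by
    intro e
    induction e with
    | _ u v =>
      rintro ⟨-, ⟨h, h'⟩ | ⟨h, h'⟩⟩
      · exact ⟨u, h, congrArg (s(u, ·)) h'⟩
      · exact ⟨v, h, (congrArg (s(v, ·)) h').trans Sym2.eq_swap⟩
  have h₁ : (parentGraph r p).edgeSet.ncard ≤ ({r}ᶜ : Set V).ncard :=
    (Set.ncard_le_ncard hsub (Set.toFinite _)).trans (Set.ncard_image_le (Set.toFinite _))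
  have h₂ := Set.ncard_add_ncard_compl ({r} : Set V)
  rw [Set.ncard_singleton] at h₂
  rw [Nat.card_coe_set_eq]
  omega

/-- In a tree, the neighbour `i` of `j` on the path from the root to `j` is the parent of `j`. This
turns the condition on the labels into one on parents, and recovers the parent map from the tree. -/
theorem exists_isPath_mem_support_iff [Finite V] (hd : ∀ v, v ≠ r → d (p v) < d v) {i j : V}
    (hij : (parentGraph r p).Adj i j) :
    (∃ q : (parentGraph r p).Walk r j, q.IsPath ∧ i ∈ q.support) ↔ j ≠ r ∧ p j = i := by
  obtain ⟨q, hq, hlt, hmem⟩ := exists_isPath_parentGraph hd j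
  constructor
  · rintro ⟨q', hq', hi⟩
    obtain rfl : q' = q := ((parentGraph_isTree hd).existsUnique_path r j).unique hq' hq
    obtain ⟨hne, ⟨h, rfl⟩ | h⟩ := hij
    · exact absurd (hd i h) (hlt i hi hne).not_gt
    · exact h
  · rintro ⟨h, rfl⟩
    exact ⟨q, hq, hmem h⟩

/-- A tree with a root comes from a parent map. -/
theorem SimpleGraph.IsTree.exists_eq_parentGraph [Finite V] {G : SimpleGraph V} (hG : G.IsTree)
    (r : V) : ∃ (p : V → V) (d : V → ℕ), (∀ v, v ≠ r → d (p v) < d v) ∧ G = parentGraph r p := by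
  choose q hq using hG.connected.exists_walk_length_eq_dist r
  have hnil : ∀ v, v ≠ r → ¬ (q v).Nil := fun v hv h => hv h.eq.symm
  have hd : ∀ v, v ≠ r → G.dist r (q v).penultimate < G.dist r v := by
    intro v hv
    have h₁ := SimpleGraph.dist_le (q v).dropLast
    have h₂ := SimpleGraph.Walk.length_dropLast_add_one (hnil v hv)
    have h₃ := hq v
    omega
  refine ⟨fun v => (q v).penultimate, G.dist r, hd, ?_⟩
  -- the edges to the parents form a connected subgraph, and a tree is minimal among those
  refine le_antisymm ((SimpleGraph.isTree_iff_minimal_connected.1 hG).2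
    (parentGraph_isTree hd).connected ?_) ?_ <;>
  · rintro u v ⟨-, ⟨h, rfl⟩ | ⟨h, rfl⟩⟩
    · exact (SimpleGraph.Walk.adj_penultimate (hnil u h)).symm
    · exact SimpleGraph.Walk.adj_penultimate (hnil v h)

end parentGraph

/-! ### Trees as forests below the root -/

/-- The labelled graph on `0, …, n - 1` given by a forest on `[1, n)` hung from `0` and a label `h`
of the root. The vertex `Fin.ofNat n (g v).1` is the parent of `v`: on `[1, n)` all parents are less
than `n`. -/
def forestGraph (n h : ℕ) [NeZero n] (g : ℕ → ℕ × ℕ) : SimpleGraph (Fin n) × (Fin n → ℕ) :=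
  (parentGraph 0 fun v => Fin.ofNat n (g v).1, fun v => if v = 0 then h else (g v).2)

section forestGraph

variable {k n h : ℕ} [NeZero n] {g : ℕ → ℕ × ℕ}

theorem Fin.one_le_val_of_ne_zero {v : Fin n} (hv : v ≠ 0) : 1 ≤ (v : ℕ) :=
  Nat.one_le_iff_ne_zero.2 fun h => hv (Fin.ext (by simpa using h))

theorem IsForest.val_ofNat {r : ℕ} (hg : IsForest k r 0 1 n g) {v : Fin n} (hv : v ≠ 0) :
    (Fin.ofNat n (g v).1 : ℕ) = (g v).1 := by
  have := hg.parent_mem v (Fin.one_le_val_of_ne_zero hv) v.2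
  have := NeZero.pos n
  exact Nat.mod_eq_of_lt (by omega)

theorem IsForest.exists_depth_fin {r : ℕ} (hg : IsForest k r 0 1 n g) :
    ∃ d : Fin n → ℕ, ∀ v : Fin n, v ≠ 0 → d (Fin.ofNat n (g v).1) < d v := by
  obtain ⟨d, hd⟩ := hg.exists_depth
  refine ⟨fun v => d v, fun v hv => ?_⟩
  simp only
  rw [hg.val_ofNat hv]
  exact hd v (Fin.one_le_val_of_ne_zero hv) v.2

theorem forestGraph_mapsTo (hh : h ∈ Set.Icc 1 k) :
    Set.MapsTo (forestGraph n h) {g | IsForest k (k + 1 - h) 0 1 n g}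
      (kNoncrossingTreesWithRoot k n h) := by
  rintro g (hg : IsForest k (k + 1 - h) 0 1 n g)
  obtain ⟨d, hd⟩ := hg.exists_depth_fin
  obtain ⟨hh₁, hhk⟩ := hh
  refine ⟨⟨parentGraph_isTree hd, ?_, ?_, ?_⟩, by simp [forestGraph]⟩
  · rw [noncrossingGraph_iff]
    have key : ∀ u v : Fin n, (forestGraph n h g).1.Adj u v → ∃ w : ℕ, 1 ≤ w ∧ w < n ∧
        min w (g w).1 = min (u : ℕ) (v : ℕ) ∧ max w (g w).1 = max (u : ℕ) (v : ℕ) := by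
      rintro u v ⟨-, ⟨hu, rfl⟩ | ⟨hu, rfl⟩⟩
      · simp only [hg.val_ofNat hu]
        exact ⟨u, Fin.one_le_val_of_ne_zero hu, u.2, rfl, rfl⟩
      · simp only [hg.val_ofNat hu]
        exact ⟨v, Fin.one_le_val_of_ne_zero hu, v.2, min_comm _ _, max_comm _ _⟩
    intro a b c e hab hbc hce hac hbe
    obtain ⟨v, hv, hv', h₁, h₂⟩ := key a c hac
    obtain ⟨w, hw, hw', h₃, h₄⟩ := key b e hbe
    have := hg.noncrossing v w hv hv' hw hw'
    omega
  · intro v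
    simp only [forestGraph]
    split_ifs with hv
    · exact ⟨hh₁, hhk⟩
    · exact ⟨hg.one_le_label v (Fin.one_le_val_of_ne_zero hv) v.2,
        hg.label_le v (Fin.one_le_val_of_ne_zero hv) v.2⟩
  · intro i j hadj hij hpath
    obtain ⟨hj, hji⟩ := (exists_isPath_mem_support_iff hd hadj).1 hpath
    have hval := hg.val_ofNat hj
    rw [hji] at hval
    have hj₁ := Fin.one_le_val_of_ne_zero hj
    simp only [forestGraph, if_neg hj]
    split_ifs with hi
    · subst hi
      have := hg.label_le_of_root j hj₁ j.2 (by simpa using hval.symm)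
      omega
    · have := hg.label_add_le j hj₁ j.2
        (by have := Fin.one_le_val_of_ne_zero hi; omega) (by rw [← hval]; exact hij)
      rwa [← hval] at this

theorem forestGraph_injOn (r : ℕ) : Set.InjOn (forestGraph n h) {g | IsForest k r 0 1 n g} := by
  rintro g (hg : IsForest k r 0 1 n g) g' (hg' : IsForest k r 0 1 n g') heq
  obtain ⟨d, hd⟩ := hg.exists_depth_fin
  obtain ⟨d', hd'⟩ := hg'.exists_depth_fin
  funext v
  by_cases hv : 1 ≤ v ∧ v < n
  swap
  · rw [hg.eq_zero v hv, hg'.eq_zero v hv]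
  have hv0 : (⟨v, hv.2⟩ : Fin n) ≠ 0 := fun h0 => by
    have := congrArg Fin.val h0
    simp at this
    omega
  have hG := congrArg Prod.fst heq
  have hf := congrFun (congrArg Prod.snd heq) ⟨v, hv.2⟩
  simp only [forestGraph] at hG hf
  rw [if_neg hv0, if_neg hv0] at hf
  have hadj := parentGraph_adj_parent hd hv0
  have hpath := (exists_isPath_mem_support_iff hd hadj).2 ⟨hv0, rfl⟩
  rw [hG] at hadj hpath
  have hp := ((exists_isPath_mem_support_iff hd' hadj).1 hpath).2
  have hval := congrArg Fin.val hp
  rw [hg.val_ofNat hv0, hg'.val_ofNat hv0] at hval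
  exact Prod.ext hval.symm hf

theorem forestGraph_surjOn :
    Set.SurjOn (forestGraph n h) {g | IsForest k (k + 1 - h) 0 1 n g}
      (kNoncrossingTreesWithRoot k n h) := by
  rintro ⟨G, f⟩ ⟨⟨hG, hnc, hlab, hadd⟩, hroot⟩
  simp only at hG hnc hlab hadd hroot
  obtain ⟨p, d, hd, rfl⟩ := hG.exists_eq_parentGraph 0
  let g : ℕ → ℕ × ℕ := fun v =>
    if hv : 1 ≤ v ∧ v < n then ((p ⟨v, hv.2⟩ : ℕ), f ⟨v, hv.2⟩) else 0
  have hg : ∀ v (h₁ : 1 ≤ v) (h₂ : v < n), g v = ((p ⟨v, h₂⟩ : ℕ), f ⟨v, h₂⟩) :=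
    fun v h₁ h₂ => dif_pos ⟨h₁, h₂⟩
  have hne : ∀ v (_ : 1 ≤ v) (h₂ : v < n), (⟨v, h₂⟩ : Fin n) ≠ 0 := by
    intro v h₁ h₂ h0
    have := congrArg Fin.val h0
    simp at this
    omega
  have hadj := fun v h₁ h₂ => parentGraph_adj_parent hd (hne v h₁ h₂)
  have hsum : ∀ v (h₁ : 1 ≤ v) (h₂ : v < n), (p ⟨v, h₂⟩ : ℕ) < v →
      f (p ⟨v, h₂⟩) + f ⟨v, h₂⟩ ≤ k + 1 := fun v h₁ h₂ hlt =>
    hadd _ _ (hadj v h₁ h₂) hlt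
      ((exists_isPath_mem_support_iff hd (hadj v h₁ h₂)).2 ⟨hne v h₁ h₂, rfl⟩)
  refine ⟨g, ⟨fun v hv => dif_neg hv, ?_, ?_, ?_, ?_, ?_, ?_, ?_⟩, ?_⟩
  · intro v h₁ h₂
    rw [hg v h₁ h₂]
    have := (p ⟨v, h₂⟩).2
    simp only
    omega
  · refine ⟨fun v => if hv : v < n then d ⟨v, hv⟩ else 0, fun v h₁ h₂ => ?_⟩
    simp only [hg v h₁ h₂, dif_pos h₂, dif_pos (p ⟨v, h₂⟩).2]
    exact hd _ (hne v h₁ h₂)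
  · intro v w hv hv' hw hw'
    rw [noncrossingGraph_iff] at hnc
    have key : ∀ v (h₁ : 1 ≤ v) (h₂ : v < n), ∃ a b : Fin n, (parentGraph 0 p).Adj a b ∧
        (a : ℕ) = min v (g v).1 ∧ (b : ℕ) = max v (g v).1 := by
      intro v h₁ h₂
      rw [hg v h₁ h₂]
      rcases le_total v (p ⟨v, h₂⟩ : ℕ) with hle | hle
      · exact ⟨⟨v, h₂⟩, p ⟨v, h₂⟩, (hadj v h₁ h₂).symm, by simp [hle]⟩
      · exact ⟨p ⟨v, h₂⟩, ⟨v, h₂⟩, hadj v h₁ h₂, by simp [hle]⟩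
    obtain ⟨a, c, hac, ha, hc⟩ := key v hv hv'
    obtain ⟨b, e, hbe, hb, he⟩ := key w hw hw'
    rintro ⟨h₁, h₂, h₃⟩
    exact hnc a b c e (Fin.lt_def.2 (by omega)) (Fin.lt_def.2 (by omega))
      (Fin.lt_def.2 (by omega)) hac hbe
  · intro v h₁ h₂
    rw [hg v h₁ h₂]
    exact (hlab _).1
  · intro v h₁ h₂
    rw [hg v h₁ h₂]
    exact (hlab _).2
  · intro v h₁ h₂
    have := hsum v h₁ h₂
    rw [hg v h₁ h₂]
    intro hp
    have hp' : p ⟨v, h₂⟩ = 0 := Fin.ext (by simpa using hp)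
    rw [hp', hroot] at this
    have := this (by simpa using Nat.pos_of_ne_zero (by omega))
    simp only
    omega
  · intro v h₁ h₂
    have := hsum v h₁ h₂
    rw [hg v h₁ h₂]
    intro hp hlt
    simp only at hp hlt ⊢
    rw [hg _ (Nat.one_le_iff_ne_zero.2 hp) (p ⟨v, h₂⟩).2]
    exact this hlt
  · have hpar : ∀ v : Fin n, v ≠ 0 → Fin.ofNat n (g v).1 = p v := by
      intro v hv
      rw [hg v (Fin.one_le_val_of_ne_zero hv) v.2]
      exact Fin.ext (Nat.mod_eq_of_lt (p v).2)
    refine Prod.ext ?_ ?_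
    · ext u v
      simp only [forestGraph, parentGraph_adj]
      refine and_congr_right fun _ => or_congr (and_congr_right fun hu => ?_)
        (and_congr_right fun hv => ?_)
      · rw [hpar u hu]
      · rw [hpar v hv]
    · funext v
      simp only [forestGraph]
      split_ifs with hv
      · rw [hv, hroot]
      · rw [hg v (Fin.one_le_val_of_ne_zero hv) v.2]

end forestGraph

/-! ### The numbers of trees -/

theorem finite_and_ncard_kNoncrossingTreesWithRoot {k n h : ℕ} [NeZero n] (hh : h ∈ Set.Icc 1 k) :
    (kNoncrossingTreesWithRoot k n h).Finite ∧
      (kNoncrossingTreesWithRoot k n h).ncard = fussCatalan k (n - 1) (k + 1 - h) := by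
  have himage : forestGraph n h '' {g | IsForest k (k + 1 - h) 0 1 n g}
      = kNoncrossingTreesWithRoot k n h :=
    Set.Subset.antisymm (forestGraph_mapsTo hh).image_subset forestGraph_surjOn
  have hcount := finite_and_card_isForest (k := k) (n - 1) (r := k + 1 - h) (ρ := 0) (x := 1)
    (by have := hh.1; omega) (Or.inl one_pos)
  rw [show 1 + (n - 1) = n by have := NeZero.pos n; omega] at hcount
  obtain ⟨hfin, hcard⟩ := hcount
  rw [← himage]
  exact ⟨Set.Finite.image _ hfin, (forestGraph_injOn _).ncard_image.trans hcard⟩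

theorem ncard_kNoncrossingTrees (k n : ℕ) [NeZero n] :
    (kNoncrossingTrees k n).ncard = ∑ r ∈ Finset.range k, fussCatalan k (n - 1) (r + 1) := by
  have hunion : kNoncrossingTrees k n = ⋃ h ∈ Set.Icc 1 k, kNoncrossingTreesWithRoot k n h := by
    ext T
    simp only [Set.mem_iUnion, kNoncrossingTreesWithRoot, kNoncrossingTrees, Set.mem_ofPred_eq]
    exact ⟨fun hT => ⟨_, hT.label_mem 0, hT, rfl⟩, fun ⟨_, _, hT, _⟩ => hT⟩
  have hdisj : (Set.Icc 1 k).PairwiseDisjoint (kNoncrossingTreesWithRoot k n ·) := by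
    intro h _ h' _ hne
    exact Set.disjoint_left.2 fun T hT hT' => hne (hT.2.symm.trans hT'.2)
  rw [hunion, (Set.finite_Icc 1 k).ncard_biUnion
    (fun h hh => (finite_and_ncard_kNoncrossingTreesWithRoot hh).1) hdisj,
    finsum_mem_congr rfl fun h hh => (finite_and_ncard_kNoncrossingTreesWithRoot hh).2,
    ← Finset.coe_Icc, finsum_mem_coe_finset]
  refine Finset.sum_nbij' (fun h => k - h) (fun r => k - r) ?_ ?_ ?_ ?_ ?_
  · intro i hi; simp at hi ⊢; omega
  · intro i hi; simp at hi ⊢; omega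
  · intro i hi; simp at hi ⊢; omega
  · intro i hi; simp at hi ⊢; omega
  · intro i hi
    simp at hi ⊢
    congr 1
    omega

theorem mainTheorem4 (k n : ℕ) [NeZero n] (hn : 1 < n) :
    ((kNoncrossingTrees k n).ncard : ℚ) =
        1 / ((n : ℚ) - 1) * ((((2 * k + 1) * (n - 1)).choose n : ℕ) : ℚ)
          - 1 / (2 * (n : ℚ) - 1) * ((((2 * k + 1) * n - k - 1).choose n : ℕ) : ℚ) ∧
      ∀ h ∈ Set.Icc 1 k,
        ((kNoncrossingTreesWithRoot k n h).ncard : ℚ) =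
          ((k : ℚ) + 1 - h) / (2 * (k : ℚ) * n - k - h + 1)
            * ((((2 * k + 1) * n - k - h - 1).choose (n - 1) : ℕ) : ℚ) := by
  obtain ⟨m, rfl⟩ : ∃ m, n = m + 2 := ⟨n - 2, by omega⟩
  constructor
  · rw [ncard_kNoncrossingTrees, show m + 2 - 1 = m + 1 by omega]
    obtain ⟨P, hP⟩ : ∃ P, P = (2 * k + 1) * (m + 1) := ⟨_, rfl⟩
    have hsum := sum_fussCatalan_eq k m k
    have h₁ := Nat.choose_succ_right_eq P (m + 1)
    have h₂ := Nat.choose_succ_right_eq (P + k) (m + 1)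
    have hP' : P = 2 * k * (m + 1) + (m + 1) := by rw [hP]; ring
    have hQ : (2 * k + 1) * (m + 2) = P + k + k + 1 := by rw [hP]; ring
    rw [show P - (m + 1) = 2 * k * (m + 1) by omega] at h₁
    rw [show P + k - (m + 1) = 2 * k * (m + 1) + k by omega] at h₂
    rw [hQ, show P + k + k + 1 - k - 1 = P + k by omega, ← hP]
    rw [← hP] at hsum
    have h₁' : (P.choose (m + 2) : ℚ) * (m + 2) = P.choose (m + 1) * (2 * k * (m + 1)) := by
      exact_mod_cast h₁
    have h₂' : ((P + k).choose (m + 2) : ℚ) * (m + 2) =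
        (P + k).choose (m + 1) * (2 * k * (m + 1) + k) := by
      exact_mod_cast h₂
    have e₁ : (((m + 2 : ℕ) : ℚ) - 1) = m + 1 := by push_cast; ring
    have e₂ : (2 * ((m + 2 : ℕ) : ℚ) - 1) = 2 * m + 3 := by push_cast; ring
    rw [e₁, e₂]
    have hm₁ : (m + 1 : ℚ) ≠ 0 := by positivity
    have hm₂ : (m + 2 : ℚ) ≠ 0 := by positivity
    have hm₃ : (2 * m + 3 : ℚ) ≠ 0 := by positivity
    refine mul_left_cancel₀ hm₂ ?_
    push_cast
    rw [hsum]
    field_simp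
    linear_combination -(2 * (m : ℚ) + 3) * h₁' + ((m : ℚ) + 1) * h₂'
  · intro h hh
    rw [(finite_and_ncard_kNoncrossingTreesWithRoot hh).2]
    obtain ⟨r, hr⟩ : ∃ r, r = k + 1 - h := ⟨_, rfl⟩
    obtain ⟨hh₁, hhk⟩ := hh
    obtain rfl : k = r + h - 1 := by omega
    obtain ⟨s, rfl⟩ : ∃ s, r = s + 1 := ⟨r - 1, by omega⟩
    rw [← hr, show m + 2 - 1 = m + 1 by omega, fussCatalan_eq_div (by omega)]
    rw [show s + 1 + h - 1 = s + h by omega]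
    have hQ : (2 * (s + h) + 1) * (m + 2) - (s + h) - h - 1
        = (2 * (s + h) + 1) * m + 2 * (s + h) + (s + 1) := by
      have : (2 * (s + h) + 1) * (m + 2)
        = (2 * (s + h) + 1) * m + 2 * (s + h) + (s + 1) + (s + h) + h + 1 := by ring
      omega
    rw [hQ]
    push_cast
    congr 2 <;> ring
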